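/- \textbf{Proposition (Achievability for MBR codes with $\alpha'=k\beta$).} Let $DSS(n,k,d,h,\alpha,\alpha',\beta,M)$ denote a distributed storage system with $n$ complete storage nodes storing $\alpha$ packets each and $h$ repairing storage nodes storing $\alpha'$ packets each, for a source file $s$ of $M$ packets. In a linear code over a finite field $F$, every stored packet is an $F$-linear combination of the packets of $s$. The reconstruction property requires that the contents of any $k$ complete nodes determine $s$. The system evolves in stages. In each stage an arbitrary complete node fails, and an arbitrary set of $d$ of the surviving complete nodes is designated. Each of these $d$ nodes and each of the $h$ repairing nodes sends to the new node $\beta$ packets that are linear combinations of the packets it stores, and the new node stores $\alpha$ linear combinations of the received packets. The repairing nodes never fail and keep their contents, and they are not used for reconstruction. Repair is functional: the new node need not equal the failed one. The coefficients are chosen without knowledge of later failures. The MBR point is defined by the constraint $\sum_{i=0}^{k-1}\min\{\alpha,(d+h-i)\beta\}\ge M$ on $\alpha,\beta\ge 0$: one first minimizes the repair-bandwidth $\gamma=(d+h)\beta$, and then, for this $\gamma$, minimizes $\alpha$. Let $1\le k\le d\le n-1$, and let $\beta,M$ be integers with $\beta\ge 1$ and $$\beta=\frac{2M}{k(2d-k+3)}.$$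 Then $h=1$, $\alpha=(d+1)\beta$ and $\beta$ are the parameters of the MBR point for $(n,k,d,M)$ with one repairing node, and a repairing node of capacity $\alpha'=k\beta$ suffices to achieve it: over every sufficiently large finite field there exist linear codes for $DSS\bigl(n,k,d,1,(d+1)\beta,k\beta,\beta,M\bigr)$, with each of the $d+1$ helpers (the $d$ complete nodes and the repairing node) sending $\beta$ packets in every repair, such that the reconstruction property holds initially and after every finite sequence of failures and repairs. -/

import Mathlib

/-- Parameters `(n, k, d, h, α, α', β, M)` of a distributed storage system: `n` complete storage
nodes of capacity `α` packets, any `k` of which must determine the source file of `M` packets, and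
`h` repairing storage nodes of capacity `α'` packets, which are used for repair only. When a
complete node fails, `d` surviving complete nodes and all `h` repairing nodes send `β` packets each
to the new node. -/
structure DSS where
  n : ℕ
  k : ℕ
  d : ℕ
  h : ℕ
  α : ℕ
  α' : ℕ
  β : ℕ
  M : ℕ

namespace DSS

/-- The cut-set bound `∑_{i<k} min {a, (d + h - i) b}` for node capacity `a` and `b` packets per
helper. -/
noncomputable def cutBound (D : DSS) (a b : ℝ) : ℝ :=
  ∑ i ∈ Finset.range D.k, min a (((D.d : ℝ) + (D.h : ℝ) - (i : ℝ)) * b)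

/-- The pair (node capacity `a`, packets per helper `b`) satisfies the cut-set constraint. -/
def Feasible (D : DSS) (a b : ℝ) : Prop :=
  0 ≤ a ∧ 0 ≤ b ∧ (D.M : ℝ) ≤ D.cutBound a b

/-- The minimum bandwidth regenerating (MBR) point: under the cut-set constraint, first the
repair-bandwidth `γ = (d + h) β` is minimized, and then the storage `α` per complete node. -/
def IsMBRPoint (D : DSS) : Prop :=
  D.Feasible D.α D.β ∧
    (∀ a b : ℝ, D.Feasible a b →
      ((D.d : ℝ) + (D.h : ℝ)) * (D.β : ℝ) ≤ ((D.d : ℝ) + (D.h : ℝ)) * b) ∧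
    (∀ a b : ℝ, D.Feasible a b →
      ((D.d : ℝ) + (D.h : ℝ)) * b = ((D.d : ℝ) + (D.h : ℝ)) * (D.β : ℝ) → (D.α : ℝ) ≤ a)

/-- The code on the complete nodes: node `i` stores the `α` packets `Q i *ᵥ s`, where `s` is the
source file of `M` packets. -/
abbrev State (D : DSS) (F : Type*) : Type _ :=
  Fin D.n → Matrix (Fin D.α) (Fin D.M) F

/-- The reconstruction property: the contents of any `k` complete nodes determine the file. -/
def Reconstructs (D : DSS) {F : Type*} [Field F] (Q : D.State F) : Prop :=
  ∀ K : Finset (Fin D.n), K.card = D.k →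
    Function.Injective (fun (s : Fin D.M → F) (i : K) => (Q i).mulVec s)

/-- One stage of the failure process: a complete node fails, and some `d` of the surviving complete
nodes are chosen as helpers. -/
structure Failure (D : DSS) where
  failed : Fin D.n
  helpers : Finset (Fin D.n)
  failed_notMem : failed ∉ helpers
  card_helpers : helpers.card = D.d

/-- The coefficients used in one repair. The complete helper `j` sends `β` linear combinations
(matrix `send j`) of its `α` stored packets, the repairing node `j` sends `β` linear combinations
(matrix `sendR j`) of its `α'` stored packets, and the new node stores `α` linear combinations
(matrices `comb j`, `combR j`) of the received packets. -/
structure RepairCoeffs (D : DSS) (F : Type*) where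
  send : Fin D.n → Matrix (Fin D.β) (Fin D.α) F
  sendR : Fin D.h → Matrix (Fin D.β) (Fin D.α') F
  comb : Fin D.n → Matrix (Fin D.α) (Fin D.β) F
  combR : Fin D.h → Matrix (Fin D.α) (Fin D.β) F

/-- The code on the complete nodes after a repair; `R` is the code on the repairing nodes. Only the
packets sent by the `d` chosen helpers and by the repairing nodes enter the new node. -/
def repair (D : DSS) {F : Type*} [Field F] (R : Fin D.h → Matrix (Fin D.α') (Fin D.M) F)
    (Q : D.State F) (e : D.Failure) (c : D.RepairCoeffs F) : D.State F :=
  Function.update Q e.failed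
    (∑ j ∈ e.helpers, c.comb j * (c.send j * Q j) + ∑ j, c.combR j * (c.sendR j * R j))

/-- A linear code for the storage system over `F`: the initial code on the complete nodes, the code
on the repairing nodes (which never fail and keep their contents), and a rule which chooses the
repair coefficients from the present state and the present failure only. -/
structure LinearCode (D : DSS) (F : Type*) where
  init : D.State F
  repairing : Fin D.h → Matrix (Fin D.α') (Fin D.M) F
  rule : D.State F → D.Failure → D.RepairCoeffs F

/-- The code on the complete nodes after the failures and repairs listed in `l`, in this order. -/
def LinearCode.stateAfter {D : DSS} {F : Type*} [Field F] (C : D.LinearCode F)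
    (l : List D.Failure) : D.State F :=
  l.foldl (fun Q e => D.repair C.repairing Q e (C.rule Q e)) C.init

/-- The code survives the dynamics of failure and (functional) repair: whatever nodes fail,
whatever helpers are chosen, and however many stages there are, the reconstruction property
always holds. -/
def LinearCode.IsRegenerating {D : DSS} {F : Type*} [Field F] (C : D.LinearCode F) : Prop :=
  ∀ l : List D.Failure, D.Reconstructs (C.stateAfter l)

end DSS

/-!
A product-matrix code with exact repair achieves the MBR point: every repair restores the content
of the failed node, so the state of the system never changes and reconstruction has to be checked
for the initial state only.

Since `M = β ∑_{i<k} (d + 1 - i)`, the file splits into `β` stripes, each of which consists of the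
free entries of a symmetric `(d + 1) × (d + 1)` matrix `W` with `W i j = 0` whenever `i, j ≥ k`
(`DSS.MessageIndex`, `DSS.messageRow`). With distinct points `x_l` of the field, the complete node
`l` stores the row `ψ_l W` of each stripe, where `ψ_l = (1, x_l, …, x_l ^ d)`. The repairing node
stores `ψ W` for the last unit vector `ψ = e_d`. As `d ≥ k`, only the first `k` entries of this row
can be nonzero, so that `k` packets per stripe suffice.

To replace node `f`, every helper sends the inner product of its row with `ψ_f`. By symmetry of `W`
the new node thus learns `⟨ψ_j, v⟩` for the `d` helpers `j`, and the entry `v d`, where `v = ψ_f W`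
is the lost row. Lagrange interpolation of degree less than `d` recovers `v`
(`DSS.sum_interpolationCoeff`, `DSS.repair_identity`). For the reconstruction from `k` nodes
(`DSS.eq_zero_of_nodes_eq_zero`), the columns `j ≥ k` of `W` have at most `k` nonzero entries and are
recovered as polynomials of degree less than `k` from `k` of their values; by symmetry the other
columns are then known except for their first `k` entries, which are recovered in the same way.

The bound `q ≥ n` on the field size is needed only for the `n` distinct points.
-/

namespace DSS

open Finset

/-! ### The MBR point -/

/-- The file size at the MBR point, without division. -/
lemma fileSize_eq {k d β M : ℕ} (hk : 1 ≤ k) (hkd : k ≤ d)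
    (hβM : (β : ℝ) = 2 * (M : ℝ) / ((k : ℝ) * (2 * (d : ℝ) - (k : ℝ) + 3))) :
    (M : ℝ) = ∑ i ∈ range k, ((d : ℝ) + 1 - i) * β := by
  have hk' : (1 : ℝ) ≤ k := by exact_mod_cast hk
  have hkd' : (k : ℝ) ≤ d := by exact_mod_cast hkd
  have hsum : ∀ m : ℕ, ∑ i ∈ range m, ((d : ℝ) + 1 - i) = m * (2 * d - m + 3) / 2 := by
    intro m
    induction m with
    | zero => simp
    | succ m ih => rw [sum_range_succ, ih]; push_cast; ring
  have h0 : (k : ℝ) * (2 * d - k + 3) ≠ 0 :=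
    (mul_pos (by linarith) (by linarith)).ne'
  rw [eq_div_iff h0] at hβM
  rw [← sum_mul, hsum]
  linarith

lemma isMBRPoint_of_fileSize (D : DSS) (hk : 1 ≤ D.k) (hkd : D.k ≤ D.d) (hβ : 0 < D.β)
    (hM : (D.M : ℝ) = ∑ i ∈ range D.k, ((D.d : ℝ) + 1 - i) * D.β)
    (hh : D.h = 1) (hα : D.α = (D.d + 1) * D.β) : D.IsMBRPoint := by
  have hβ' : (0 : ℝ) < D.β := by exact_mod_cast hβ
  have hpos : ∀ i ∈ range D.k, (0 : ℝ) < (D.d : ℝ) + 1 - i := by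
    intro i hi
    have : (i : ℝ) < D.d := by exact_mod_cast (mem_range.1 hi).trans_le hkd
    linarith
  have hS : 0 < ∑ i ∈ range D.k, ((D.d : ℝ) + 1 - i) :=
    sum_pos hpos ⟨0, mem_range.2 hk⟩
  refine ⟨⟨by positivity, hβ'.le, ?_⟩, ?_, ?_⟩
  · rw [hM, cutBound]
    refine (sum_congr rfl fun i _ => ?_).le
    rw [hα, hh]
    push_cast
    rw [min_eq_right]
    exact mul_le_mul_of_nonneg_right (by linarith [(Nat.cast_nonneg i : (0 : ℝ) ≤ i)]) hβ'.le
  · rintro a b ⟨-, -, h⟩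
    refine mul_le_mul_of_nonneg_left ?_ (by positivity)
    have h2 : D.cutBound a b ≤ ∑ i ∈ range D.k, ((D.d : ℝ) + 1 - i) * b :=
      sum_le_sum fun i _ => by rw [hh]; push_cast; exact min_le_right _ _
    have h3 := (hM ▸ h).trans h2
    rw [← sum_mul, ← sum_mul] at h3
    exact le_of_mul_le_mul_left h3 hS
  · rintro a b ⟨-, -, h⟩ hb
    have hb' : b = D.β := mul_left_cancel₀ (by rw [hh]; positivity) hb
    subst hb'
    by_contra! ha
    -- If `a < α`, then the term `i = 0` of the cut-set bound is too small.
    refine (h.trans_lt ?_).ne hM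
    rw [cutBound]
    refine sum_lt_sum (fun i _ => by rw [hh]; push_cast; exact min_le_right _ _)
      ⟨0, mem_range.2 hk, (min_le_left _ _).trans_lt ?_⟩
    rw [hα] at ha
    push_cast at ha ⊢
    linarith

/-! ### Message matrices -/

/-- The free entries `(i, j)`, `i < k`, `i ≤ j ≤ d`, of a symmetric `(d + 1) × (d + 1)` matrix whose
entries with both indices at least `k` vanish. -/
abbrev MessageIndex (k d : ℕ) : Type :=
  (i : Fin k) × {j : Fin (d + 1) // (i : ℕ) ≤ j}

lemma card_messageIndex (k d : ℕ) :
    Fintype.card (MessageIndex k d) = ∑ i ∈ range k, (d + 1 - i) := by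
  rw [Fintype.card_sigma, ← Fin.sum_univ_eq_sum_range (fun i => d + 1 - i)]
  refine sum_congr rfl fun i _ => ?_
  rcases le_or_gt (d + 1) i with h | h
  · rw [Nat.sub_eq_zero_of_le h, Fintype.card_eq_zero_iff]
    exact ⟨fun j => by have := j.2; have := j.1.2; omega⟩
  · rw [Fintype.card_subtype, ← Fin.card_Ici ⟨i, h⟩]
    congr 1
    ext j
    simp [Fin.le_def]

variable {F : Type*} [Field F] {k d β : ℕ} {ι : Type*} [DecidableEq ι]

/-- The free entry `(i, j)` of the message matrix in stripe `b`, as a linear form in the file, whose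
packets are numbered by `e`; zero if `(i, j)` is not the position of a free entry. -/
def freeRow (F : Type*) [Field F] (e : MessageIndex k d × Fin β ≃ ι) (b : Fin β)
    (i j : Fin (d + 1)) : ι → F :=
  if h : (i : ℕ) < k ∧ i ≤ j then Pi.single (e (⟨⟨i, h.1⟩, ⟨j, h.2⟩⟩, b)) 1 else 0

/-- The entry `(i, j)` of the message matrix in stripe `b`, as a linear form in the file. -/
def messageRow (F : Type*) [Field F] (e : MessageIndex k d × Fin β ≃ ι) (b : Fin β)
    (i j : Fin (d + 1)) : ι → F :=
  freeRow F e b (min i j) (max i j)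

lemma messageRow_comm (e : MessageIndex k d × Fin β ≃ ι) (b : Fin β) (i j : Fin (d + 1)) :
    messageRow F e b i j = messageRow F e b j i := by
  rw [messageRow, messageRow, min_comm, max_comm]

lemma messageRow_eq_zero (e : MessageIndex k d × Fin β ≃ ι) (b : Fin β) {i j : Fin (d + 1)}
    (hi : k ≤ i) (hj : k ≤ j) : messageRow F e b i j = 0 := by
  rw [messageRow, freeRow, dif_neg]
  rcases min_choice i j with h | h <;> rw [h] <;> omega

lemma exists_messageRow_eq_single (e : MessageIndex k d × Fin β ≃ ι) (hkd : k ≤ d) (m : ι) :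
    ∃ b i j, messageRow F e b i j = Pi.single m 1 := by
  obtain ⟨⟨⟨i, j, hij⟩, b⟩, rfl⟩ := e.surjective m
  have hi : (i : ℕ) < d + 1 := by omega
  have hle : (⟨i, hi⟩ : Fin (d + 1)) ≤ j := hij
  refine ⟨b, ⟨i, hi⟩, j, ?_⟩
  rw [messageRow, min_eq_left hle, max_eq_right hle, freeRow, dif_pos ⟨i.2, hle⟩]

/-! ### Reconstruction -/

lemma eq_zero_of_forall_sum_pow_mul_eq_zero {κ : Type*} {K : Finset κ} {x : κ → F}
    (hx : Function.Injective x) {c : Fin (d + 1) → F} (hc : ∀ i, #K ≤ i.1 → c i = 0)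
    (h : ∀ l ∈ K, ∑ i : Fin (d + 1), x l ^ (i : ℕ) * c i = 0) : c = 0 := by
  let p : Polynomial F := ∑ i : Fin (d + 1), Polynomial.monomial (i : ℕ) (c i)
  have hcoeff : ∀ i : Fin (d + 1), p.coeff i = c i := by
    intro i
    simp [p, Polynomial.finsetSum_coeff, Polynomial.coeff_monomial, Fin.val_inj]
  have hp : p = 0 := by
    refine Polynomial.eq_zero_of_degree_lt_of_eval_index_eq_zero K hx.injOn ?_ ?_
    · rw [Polynomial.degree_lt_iff_coeff_zero]
      intro m hm
      simp only [p, Polynomial.finsetSum_coeff, Polynomial.coeff_monomial]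
      refine sum_eq_zero fun i _ => ?_
      split_ifs with him
      · exact hc i (him ▸ hm)
      · rfl
    · intro l hl
      rw [← h l hl]
      simp [p, Polynomial.eval_finsetSum, mul_comm]
  ext i
  rw [← hcoeff, hp, Polynomial.coeff_zero, Pi.zero_apply]

/-- A message matrix is determined by the rows stored at `k` nodes. -/
lemma eq_zero_of_nodes_eq_zero {κ : Type*} {K : Finset κ} {x : κ → F}
    (hx : Function.Injective x) {w : Fin (d + 1) → Fin (d + 1) → F}
    (hw : ∀ i j, w i j = w j i) (hw0 : ∀ i j : Fin (d + 1), #K ≤ i.1 → #K ≤ j.1 → w i j = 0)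
    (h : ∀ l ∈ K, ∀ j, ∑ i : Fin (d + 1), x l ^ (i : ℕ) * w i j = 0) (i j : Fin (d + 1)) : w i j = 0 := by
  have h1 : ∀ j : Fin (d + 1), #K ≤ j.1 → (fun i => w i j) = 0 := fun j hj =>
    eq_zero_of_forall_sum_pow_mul_eq_zero hx (fun i hi => hw0 i j hi hj) fun l hl => h l hl j
  have h2 : (fun i => w i j) = 0 :=
    eq_zero_of_forall_sum_pow_mul_eq_zero hx
      (fun i hi => (hw i j).trans (congrFun (h1 i hi) j)) fun l hl => h l hl j
  exact congrFun h2 i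

/-! ### Exact repair -/

variable {κ : Type*} [DecidableEq κ]

/-- The weight of the value at `x l` in the coefficient of degree `i` of the interpolation
polynomial through the points `x l`, `l ∈ H`. -/
noncomputable def interpolationCoeff (x : κ → F) (H : Finset κ) (i : Fin (d + 1)) (l : κ) : F :=
  (Lagrange.basis H x l).coeff i

/-- The weight of the top coefficient `v d` when `v i` is computed from `v d` and the values at
`x l`, `l ∈ H`, of the polynomial with coefficients `v`. -/
noncomputable def topCoeff (x : κ → F) (H : Finset κ) (i : Fin (d + 1)) : F :=
  (if i = Fin.last d then 1 else 0) - ∑ l ∈ H, interpolationCoeff x H i l * x l ^ d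

lemma sum_interpolationCoeff {x : κ → F} (hx : Function.Injective x) {H : Finset κ} (hH : #H = d)
    (i t : Fin (d + 1)) :
    ∑ l ∈ H, interpolationCoeff x H i l * x l ^ (t : ℕ) +
      topCoeff x H i * (if t = Fin.last d then 1 else 0) = if i = t then 1 else 0 := by
  by_cases ht : t = Fin.last d
  · subst ht
    simp [topCoeff]
  · have htd : (t : ℕ) < #H := by
      rw [hH]
      exact Fin.val_lt_last ht
    have h := Lagrange.eq_interpolate (s := H) (v := x)
      (f := (Polynomial.X : Polynomial F) ^ (t : ℕ)) hx.injOn (by rw [Polynomial.degree_X_pow]; exact_mod_cast htd)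
    have h' := congrArg (fun p => p.coeff (i : ℕ)) h
    simp only [Lagrange.interpolate_apply, Polynomial.finsetSum_coeff, Polynomial.coeff_C_mul,
      Polynomial.coeff_X_pow, Polynomial.eval_pow, Polynomial.eval_X, Fin.val_inj] at h'
    rw [h', if_neg ht, mul_zero, add_zero]
    exact sum_congr rfl fun l _ => mul_comm _ _

/-- A vector is recovered from its inner products with the vectors `(1, x l, …, x l ^ d)`, `l ∈ H`,
and from its last entry. -/
lemma sum_interpolationCoeff_mul {x : κ → F} (hx : Function.Injective x) {H : Finset κ}
    (hH : #H = d) (v : Fin (d + 1) → F) (i : Fin (d + 1)) :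
    ∑ l ∈ H, interpolationCoeff x H i l * ∑ t : Fin (d + 1), x l ^ (t : ℕ) * v t +
      topCoeff x H i * v (Fin.last d) = v i := by
  calc _ = ∑ t : Fin (d + 1), (∑ l ∈ H, interpolationCoeff x H i l * x l ^ (t : ℕ) +
        topCoeff x H i * (if t = Fin.last d then 1 else 0)) * v t := by
        simp only [add_mul, sum_add_distrib, sum_mul, mul_sum]
        rw [sum_comm]
        simp [mul_assoc]
    _ = v i := by
        simp only [sum_interpolationCoeff hx hH]
        simp

/-- The lost row `ψ_f w` of a message matrix `w` in terms of the inner products of the helpers' rows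
with `ψ_f`. The repairing node contributes with the first `k` entries of the last row of `w`. -/
lemma repair_identity {x : κ → F} (hx : Function.Injective x) {H : Finset κ} (hH : #H = d)
    (hkd : k ≤ d) {w : Fin (d + 1) → Fin (d + 1) → F} (hw : ∀ i j, w i j = w j i)
    (hw0 : ∀ i j : Fin (d + 1), k ≤ i.1 → k ≤ j.1 → w i j = 0) (f : κ) (i : Fin (d + 1)) :
    ∑ l ∈ H, interpolationCoeff x H i l *
        (∑ j : Fin (d + 1), x f ^ (j : ℕ) * ∑ t : Fin (d + 1), x l ^ (t : ℕ) * w t j) +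
      topCoeff x H i * (∑ j : Fin k, x f ^ (j : ℕ) * w (j.castLE (by omega)) (Fin.last d)) =
    ∑ t : Fin (d + 1), x f ^ (t : ℕ) * w t i := by
  rw [← sum_interpolationCoeff_mul hx hH (fun i => ∑ t : Fin (d + 1), x f ^ (t : ℕ) * w t i) i]
  congr 1
  · refine sum_congr rfl fun l _ => ?_
    simp only [mul_sum]
    rw [sum_comm]
    refine sum_congr rfl fun t _ => sum_congr rfl fun j _ => ?_
    rw [hw t j]
    ring
  · have hk : k ≤ d + 1 := by omega
    congr 1
    refine sum_of_injOn (Fin.castLE hk) (Fin.castLE_injective hk).injOn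
      (fun _ _ => mem_coe.2 (mem_univ _)) (fun t _ ht => ?_) fun _ _ => rfl
    rw [hw0 t _ ?_ (by simpa using hkd), mul_zero]
    by_contra! htk
    exact ht ⟨⟨t, htk⟩, by simp, rfl⟩

/-! ### The code -/

/-- The product-matrix code with evaluation points `x`. The packets of the file, of a complete node
and of the repairing node are numbered by `eM`, `eα` and `eα'`; the second component of each index
is the stripe, and stripes are encoded and repaired independently. -/
noncomputable def productMatrixCode (D : DSS) (hkd : D.k ≤ D.d) (x : Fin D.n → F)
    (eM : MessageIndex D.k D.d × Fin D.β ≃ Fin D.M)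
    (eα : Fin D.α ≃ Fin (D.d + 1) × Fin D.β) (eα' : Fin D.α' ≃ Fin D.k × Fin D.β) :
    D.LinearCode F where
  init l := .of fun p => ∑ i : Fin (D.d + 1), x l ^ (i : ℕ) • messageRow F eM (eα p).2 i (eα p).1
  repairing _ := .of fun p =>
    messageRow F eM (eα' p).2 ((eα' p).1.castLE (by omega)) (Fin.last D.d)
  rule _ e :=
    { send := fun _ => .of fun b p => if (eα p).2 = b then x e.failed ^ ((eα p).1 : ℕ) else 0
      sendR := fun _ => .of fun b p => if (eα' p).2 = b then x e.failed ^ ((eα' p).1 : ℕ) else 0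
      comb := fun l => .of fun p b =>
        if (eα p).2 = b then interpolationCoeff x e.helpers (eα p).1 l else 0
      combR := fun _ => .of fun p b =>
        if (eα p).2 = b then topCoeff x e.helpers (eα p).1 else 0 }

/-- Every repair is exact: it restores the content of the failed node. -/
lemma productMatrixCode_stateAfter (D : DSS) (hkd : D.k ≤ D.d) (hh : D.h = 1) {x : Fin D.n → F}
    (hx : Function.Injective x) (eM : MessageIndex D.k D.d × Fin D.β ≃ Fin D.M)
    (eα : Fin D.α ≃ Fin (D.d + 1) × Fin D.β) (eα' : Fin D.α' ≃ Fin D.k × Fin D.β)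
    (l : List D.Failure) :
    (productMatrixCode D hkd x eM eα eα').stateAfter l =
      (productMatrixCode D hkd x eM eα eα').init := by
  set C := productMatrixCode D hkd x eM eα eα' with hC
  have hstep : ∀ e : D.Failure, D.repair C.repairing C.init e (C.rule C.init e) = C.init := by
    intro e
    rw [repair, Function.update_eq_self_iff]
    ext p m
    have hid := repair_identity hx e.card_helpers hkd
      (w := fun i j => messageRow F eM (eα p).2 i j m)
      (fun i j => congrFun (messageRow_comm eM _ i j) m)
      (fun i j hi hj => congrFun (messageRow_eq_zero eM _ hi hj) m) e.failed (eα p).1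
    have : Unique (Fin D.h) := hh ▸ inferInstanceAs (Unique (Fin 1))
    -- The sums over packets become double sums, in which only the stripe of `p` contributes.
    have hsum : ∀ g : Fin D.α → F, ∑ q, g q = ∑ j, ∑ b, g (eα.symm (j, b)) := fun g => by
      rw [← Fintype.sum_prod_type', ← eα.symm.sum_comp]
    have hsum' : ∀ g : Fin D.α' → F, ∑ q, g q = ∑ j, ∑ b, g (eα'.symm (j, b)) := fun g => by
      rw [← Fintype.sum_prod_type', ← eα'.symm.sum_comp]
    simp only [hC, productMatrixCode, Matrix.add_apply, Matrix.sum_apply, Matrix.mul_apply,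
      Matrix.of_apply, Finset.sum_apply, Pi.smul_apply, smul_eq_mul, ite_mul, zero_mul,
      sum_ite_eq, mem_univ, if_true, hsum, hsum', Equiv.apply_symm_apply, sum_ite_eq',
      Fintype.sum_unique]
    exact hid
  induction l with
  | nil => rfl
  | cons e l ih =>
    rw [LinearCode.stateAfter, List.foldl_cons, hstep]
    exact ih

lemma productMatrixCode_reconstructs (D : DSS) (hkd : D.k ≤ D.d) {x : Fin D.n → F}
    (hx : Function.Injective x) (eM : MessageIndex D.k D.d × Fin D.β ≃ Fin D.M)
    (eα : Fin D.α ≃ Fin (D.d + 1) × Fin D.β) (eα' : Fin D.α' ≃ Fin D.k × Fin D.β) :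
    D.Reconstructs (productMatrixCode D hkd x eM eα eα').init := by
  intro K hK s s' hss
  rw [← sub_eq_zero]
  set u := s - s' with hu
  have hnode : ∀ l ∈ K, ∀ p, (((productMatrixCode D hkd x eM eα eα').init l).mulVec u) p = 0 := by
    intro l hl p
    have := congrFun (congrFun hss ⟨l, hl⟩) p
    rw [hu, Matrix.mulVec_sub, Pi.sub_apply, sub_eq_zero]
    exact this
  have hentry : ∀ b i j, messageRow F eM b i j ⬝ᵥ u = 0 := by
    intro b
    refine eq_zero_of_nodes_eq_zero (K := K) hx (fun i j => by rw [messageRow_comm])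
      (fun i j hi hj => ?_) fun l hl j => ?_
    · rw [messageRow_eq_zero eM b (hK ▸ hi) (hK ▸ hj), zero_dotProduct]
    · rw [← hnode l hl (eα.symm (j, b))]
      rw [Matrix.mulVec, productMatrixCode]
      simp only [← smul_eq_mul, ← smul_dotProduct, ← sum_dotProduct]
      exact congrArg (· ⬝ᵥ u) (by ext; simp)
  ext m
  obtain ⟨b, i, j, h⟩ := exists_messageRow_eq_single (F := F) eM hkd m
  have := hentry b i j
  rwa [h, single_one_dotProduct] at this

end DSS

theorem mainTheorem5 (D : DSS) (hk : 1 ≤ D.k) (hkd : D.k ≤ D.d) (hdn : D.d ≤ D.n - 1)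
    (hβ : 0 < D.β)
    (hβM : (D.β : ℝ) = 2 * (D.M : ℝ) / ((D.k : ℝ) * (2 * (D.d : ℝ) - (D.k : ℝ) + 3)))
    (hh : D.h = 1) (hα : D.α = (D.d + 1) * D.β) (hα' : D.α' = D.k * D.β) :
    D.IsMBRPoint ∧
      ∃ q₀ : ℕ, ∀ (F : Type) [Field F] [Fintype F], q₀ ≤ Fintype.card F →
        ∃ C : D.LinearCode F, C.IsRegenerating := by
  have hM := DSS.fileSize_eq hk hkd hβM
  refine ⟨D.isMBRPoint_of_fileSize hk hkd hβ hM hh hα, D.n, fun F _ _ hF => ?_⟩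
  have hMnat : D.M = (∑ i ∈ Finset.range D.k, (D.d + 1 - i)) * D.β := by
    have : (D.M : ℝ) = ((∑ i ∈ Finset.range D.k, (D.d + 1 - i)) * D.β : ℕ) := by
      rw [hM, Nat.cast_mul, Nat.cast_sum, Finset.sum_mul]
      refine Finset.sum_congr rfl fun i hi => ?_
      rw [Nat.cast_sub (by have := Finset.mem_range.1 hi; omega)]
      push_cast
      rfl
    exact_mod_cast this
  obtain ⟨x⟩ : Nonempty (Fin D.n ↪ F) :=
    Function.Embedding.nonempty_of_card_le (by rwa [Fintype.card_fin])
  have eM : DSS.MessageIndex D.k D.d × Fin D.β ≃ Fin D.M :=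
    Fintype.equivOfCardEq (by
      rw [Fintype.card_prod, DSS.card_messageIndex, Fintype.card_fin, Fintype.card_fin, hMnat])
  have eα : Fin D.α ≃ Fin (D.d + 1) × Fin D.β := (finCongr hα).trans finProdFinEquiv.symm
  have eα' : Fin D.α' ≃ Fin D.k × Fin D.β := (finCongr hα').trans finProdFinEquiv.symm
  refine ⟨DSS.productMatrixCode D hkd x eM eα eα', fun l => ?_⟩
  rw [DSS.productMatrixCode_stateAfter D hkd hh x.injective]
  exact DSS.productMatrixCode_reconstructs D hkd x.injective eM eα eα'
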